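/- Let $k$ be an arbitrary field and let $A$ be an associative unital $k$-algebra. "Finite-dimensional" means finite-dimensional over $k$, where a left $A$-module is a $k$-vector space through $k \to A$. A left $A$-module is \emph{locally finite} (or locally finite-dimensional) if each of its finitely generated submodules is finite-dimensional. The algebra $A$ is \emph{left fully residually finite-dimensional} (left fully RFD) if every finitely generated left $A$-module $M$ is a subdirect product of finite-dimensional left $A$-modules, i.e. there are finite-dimensional left $A$-modules $N_i$ ($i \in I$) and an injective $A$-linear map $M \to \prod_{i \in I} N_i$ all of whose components $M \to N_i$ are surjective. The \emph{finite dual} $A^\circ$ is the set of $\phi \in A^* = \operatorname{Hom}_k(A,k)$ whose kernel contains a two-sided ideal of finite codimension in $A$; it is a left $A$-module through $(a\phi)(b) = \phi(ba)$. A left $A$-module $U$ is a \emph{cogenerator} in the category $A\text{-Mod}$ of left $A$-modules if the functor $\operatorname{Hom}_A(-,U)$ is faithful. The following are equivalent: (a) $A$ is left fully RFD; (b) the injective hull of every simple left $A$-module is locally finite-dimensional; (c) $A^\circ$ is a cogenerator in $A\text{-Mod}$. If moreover $A$ is left noetherian, then these properties are further equivalent to each of the following: (d) every simple left $A$-module is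 finite-dimensional, and the injective hull in $A\text{-Mod}$ of every locally finite left $A$-module is locally finite; (e) $A^\circ$ is an injective cogenerator in $A\text{-Mod}$, i.e. it is a cogenerator and an injective object of $A\text{-Mod}$. -/

import Mathlib

universe u v w w'

/-! ## Finite-dimensional and locally finite modules -/

section FiniteDimensionality

variable (k : Type u) (A : Type v) [Field k] [Ring A] [Algebra k A]

/-- A left module `M` over the `k`-algebra `A` is finite-dimensional if it is so as a `k`-vector
space, the scalar action of `k` being the one through `k → A`. -/
def IsFinDimModule (M : Type w) [AddCommGroup M] [Module A M] : Prop :=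
  Module.Finite k (RestrictScalars k A M)

/-- If a compatible `k`-action on `M` is already given, finite-dimensionality may be tested
with it. -/
theorem isFinDimModule_iff (M : Type w) [AddCommGroup M] [Module A M] [Module k M]
    [IsScalarTower k A M] : IsFinDimModule k A M ↔ Module.Finite k M := by
  let e : RestrictScalars k A M ≃ₗ[k] M :=
    { RestrictScalars.addEquiv k A M with
      map_smul' := fun c x => by
        change algebraMap k A c • RestrictScalars.addEquiv k A M x =
          c • RestrictScalars.addEquiv k A M x
        rw [algebraMap_smul] }
  exact Module.Finite.equiv_iff e

/-- A left `A`-module is locally finite(-dimensional) if each of its finitely generated submodules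
is finite-dimensional. -/
def IsLocallyFiniteModule (M : Type w) [AddCommGroup M] [Module A M] : Prop :=
  ∀ N : Submodule A M, N.FG → IsFinDimModule k A N

end FiniteDimensionality

/-! ## Subdirect products and the left fully RFD property -/

/-- `M` is a subdirect product of the family `N` of left `A`-modules: it embeds into `∏ i, N i`
in such a way that each coordinate projection `M → N i` is surjective. -/
def IsSubdirectProduct (A : Type v) [Ring A] (M : Type w) [AddCommGroup M] [Module A M]
    {ι : Type w'} (N : ι → ModuleCat.{w} A) : Prop :=
  ∃ f : M →ₗ[A] (∀ i, N i),
    Function.Injective f ∧ ∀ i, Function.Surjective fun m => f m i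

/-- `A` is left fully residually finite-dimensional: every finitely generated left `A`-module is a
subdirect product of finite-dimensional left `A`-modules. -/
def IsLeftFullyRFD (k : Type u) (A : Type v) [Field k] [Ring A] [Algebra k A] : Prop :=
  ∀ (M : Type (max u v)) [AddCommGroup M] [Module A M], Module.Finite A M →
    ∃ (ι : Type (max u v)) (N : ι → ModuleCat.{max u v} A),
      (∀ i, IsFinDimModule k A (N i)) ∧ IsSubdirectProduct A M N

/-! ## Injective hulls -/

/-- The `A`-linear map `i : M → E` exhibits `E` as an injective hull of `M`: the module `E` is
injective, and `i` is an embedding with essential image. -/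
structure IsInjectiveHull {A : Type v} [Ring A] {M E : Type w} [AddCommGroup M] [Module A M]
    [AddCommGroup E] [Module A E] (i : M →ₗ[A] E) : Prop where
  injective_module : Module.Injective A E
  injective : Function.Injective i
  essential : ∀ N : Submodule A E, N ⊓ LinearMap.range i = ⊥ → N = ⊥

/-! ## The finite dual as a left module -/

section FiniteDual

variable (k : Type u) (A : Type v) [Field k] [Ring A] [Algebra k A]

/-- The subspace `A° ⊆ A*` of the functionals whose kernel contains a two-sided ideal of finite
codimension. -/
def finiteDualSubspace : Submodule k (Module.Dual k A) where
  carrier := {φ | ∃ I : Ideal A, I.IsTwoSided ∧ Module.Finite k (A ⧸ I) ∧ ∀ x ∈ I, φ x = 0}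
  zero_mem' := ⟨⊤, inferInstance, inferInstance, fun _ _ => rfl⟩
  add_mem' := by
    rintro φ ψ ⟨I, hI, hIf, hφ⟩ ⟨J, hJ, hJf, hψ⟩
    refine ⟨I ⊓ J, ⟨fun b h => ⟨I.mul_mem_right b h.1, J.mul_mem_right b h.2⟩⟩, ?_,
      fun x hx => ?_⟩
    · let g : A →ₗ[k] (A ⧸ I) × (A ⧸ J) :=
        (I.mkQ.restrictScalars k).prod (J.mkQ.restrictScalars k)
      have hg : LinearMap.ker g = (I ⊓ J).restrictScalars k := by
        ext x
        simp [g]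
      have e : (A ⧸ (I ⊓ J).restrictScalars k) ≃ₗ[k] LinearMap.range g :=
        (Submodule.quotEquivOfEq _ _ hg.symm).trans g.quotKerEquivRange
      exact Module.Finite.equiv
        (e.symm.trans (Submodule.Quotient.restrictScalarsEquiv k (I ⊓ J)))
    · rw [LinearMap.add_apply, hφ x hx.1, hψ x hx.2, add_zero]
  smul_mem' := by
    rintro c φ ⟨I, hI, hIf, hφ⟩
    exact ⟨I, hI, hIf, fun x hx => by rw [LinearMap.smul_apply, hφ x hx, smul_zero]⟩

/-- The finite dual `A°` of the `k`-algebra `A`. -/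
def FiniteDual : Type (max u v) := finiteDualSubspace k A

noncomputable instance : AddCommGroup (FiniteDual k A) :=
  inferInstanceAs (AddCommGroup (finiteDualSubspace k A))

/-- The usual left `A`-action on `A°`: `(a • φ) b = φ (b * a)`. -/
noncomputable instance : Module A (FiniteDual k A) where
  smul a φ := ⟨φ.1.comp (LinearMap.mulRight k a), by
    obtain ⟨φ, I, hI, hIf, hφ⟩ := φ
    exact ⟨I, hI, hIf, fun x hx => hφ _ (I.mul_mem_right a hx)⟩⟩
  one_smul φ := Subtype.ext (LinearMap.ext fun b => congrArg φ.1 (mul_one b))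
  mul_smul a a' φ := Subtype.ext (LinearMap.ext fun b => congrArg φ.1 (mul_assoc b a a').symm)
  smul_zero _ := rfl
  smul_add _ _ _ := rfl
  add_smul a a' φ := Subtype.ext (LinearMap.ext fun b =>
    (congrArg φ.1 (mul_add b a a')).trans (map_add φ.1 _ _))
  zero_smul φ := Subtype.ext (LinearMap.ext fun b =>
    (congrArg φ.1 (mul_zero b)).trans (map_zero φ.1))

theorem FiniteDual.smul_apply (a : A) (φ : FiniteDual k A) (b : A) :
    (a • φ).1 b = φ.1 (b * a) := rfl

end FiniteDual

/-! On a locally finite module `M`, every `k`-linear functional `l` induces an `A`-linear map `M →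
A°`, `m ↦ (b ↦ l (b • m))` (`toFiniteDual`), so `A°` plays the role that `k` has for vector spaces.
(a) ⇒ (b): if a finitely generated `N` has an artinian essential submodule `F`, finitely many
finite-dimensional quotients already separate `F` from zero; by essentiality they separate `N`, so
`N` is finite-dimensional. (b) ⇒ (c): a nonzero element survives in the hull of some simple module,
and a functional carries it on to `A°`. (c) ⇒ (a): `A°` is locally finite, so finitely generated
modules have finite-dimensional images in it. For noetherian `A` the first argument also covers
hulls of locally finite modules, giving (d); then `A°` is a retract of its own hull, giving (e). -/

open CategoryTheory in
/-- Every module has an injective hull. -/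
theorem exists_isInjectiveHull {A : Type v} [Ring A] [Small.{w} A] (M : Type w) [AddCommGroup M]
    [Module A M] :
    ∃ (E : Type w) (_ : AddCommGroup E) (_ : Module A E) (i : M →ₗ[A] E), IsInjectiveHull i := by
  obtain ⟨⟨Q, hQ, j, hj⟩⟩ := EnoughInjectives.presentation (ModuleCat.of A M)
  have hQi : Module.Injective A Q := Module.injective_module_of_injective_object A Q
  have hji : Function.Injective j.hom := (ModuleCat.mono_iff_injective j).1 hj
  let M' : Submodule A Q := LinearMap.range j.hom
  -- Essentiality over `M'`, stated elementwise so that it passes to unions of chains.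
  let S : Set (Submodule A Q) := {N | ∀ x ∈ N, x ≠ 0 → ∃ a : A, a • x ∈ M' ∧ a • x ≠ 0}
  obtain ⟨E, hME, hE⟩ := zorn_le_nonempty₀ S (fun c hcS hc N hN => by
    refine ⟨sSup c, fun x hx hx0 => ?_, fun z hz => le_sSup hz⟩
    obtain ⟨L, hL, hxL⟩ := (Submodule.mem_sSup_of_directed ⟨N, hN⟩ hc.directedOn).1 hx
    exact hcS hL x hxL hx0) M' (fun x hx hx0 => ⟨1, by simpa using hx, by simpa using hx0⟩)
  obtain ⟨C, -, hC⟩ := zorn_le_nonempty₀ {C : Submodule A Q | Disjoint E C}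
    (fun c hcS hc N hN => ⟨sSup c, hc.directedOn.disjoint_sSup_right.2 hcS,
      fun z hz => le_sSup hz⟩) ⊥ disjoint_bot_right
  have hCE : ∀ x ∈ E, x ∈ C → x = 0 := Submodule.disjoint_def.1 hC.prop
  -- `E` embeds in `Q ⧸ C`, so its inclusion into `Q` extends to a map `r` that fixes `E` and kills
  -- `C`.
  obtain ⟨g, hg⟩ := hQi.out (C.mkQ.comp E.subtype) (by
    refine (injective_iff_map_eq_zero _).2 fun x hx => ?_
    have : (x : Q) ∈ C := by simpa using hx
    exact Subtype.ext (hCE x x.2 this)) E.subtype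
  let r : Q →ₗ[A] Q := g.comp C.mkQ
  have hr : ∀ x ∈ E, r x = x := fun x hx => hg ⟨x, hx⟩
  -- submodules meeting `E` trivially have preimage `C` under `r`
  have key : ∀ L : Submodule A Q, Disjoint E L → L.comap r ≤ C := fun L hL => by
    refine hC.le_of_ge (Submodule.disjoint_def.2 fun x hxE hxL => ?_) fun x hx => ?_
    · exact Submodule.disjoint_def.1 hL x hxE (by simpa [hr x hxE] using hxL)
    · have : r x = 0 := by simp [r, (Submodule.Quotient.mk_eq_zero C).2 hx]
      simp [this]
  -- The range of `r` is essential over `E`, hence over `M'`. Maximality of `E` makes it a retract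
  -- of `Q`.
  have hrange : LinearMap.range r ≤ E := by
    refine hE.le_of_ge ?_ fun x hx => ⟨x, hr x hx⟩
    rintro _ ⟨y, rfl⟩ hy0
    have hnd : ¬ Disjoint E (Submodule.span A {r y}) := fun hd => by
      have hyC : y ∈ C := key _ hd (Submodule.mem_span_singleton_self _)
      exact hy0 (by simp [r, (Submodule.Quotient.mk_eq_zero C).2 hyC])
    simp only [Submodule.disjoint_def, not_forall] at hnd
    obtain ⟨x, hxE, hxs, hx0⟩ := hnd
    obtain ⟨a, rfl⟩ := Submodule.mem_span_singleton.1 hxs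
    obtain ⟨b, hb, hb0⟩ := hE.prop _ hxE hx0
    exact ⟨b * a, by rwa [mul_smul], by rwa [mul_smul]⟩
  refine ⟨E, inferInstance, inferInstance,
    j.hom.codRestrict E fun x => hME ⟨x, rfl⟩, ⟨fun X Y _ _ _ _ f hf φ => ?_⟩, ?_, fun N hN => ?_⟩
  · obtain ⟨h, hh⟩ := hQi.out f hf (E.subtype.comp φ)
    refine ⟨(r.comp h).codRestrict E fun y => hrange ⟨h y, rfl⟩, fun x => Subtype.ext ?_⟩
    change r (h (f x)) = _
    rw [hh]
    exact hr _ (φ x).2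
  · exact fun x y hxy => hji (congrArg Subtype.val hxy)
  · refine (Submodule.eq_bot_iff _).2 fun x hx => by_contra fun hx0 => ?_
    obtain ⟨a, ⟨m, hm⟩, ha0⟩ := hE.prop x x.2 (fun h => hx0 (Subtype.ext h))
    have : a • x ∈ N ⊓ LinearMap.range (j.hom.codRestrict E fun x => hME ⟨x, rfl⟩) :=
      ⟨N.smul_mem a hx, m, Subtype.ext hm⟩
    rw [hN, Submodule.mem_bot] at this
    exact ha0 (congrArg Subtype.val this)

/-! ### Permanence of finite-dimensionality -/

section FiniteDimensionality

variable {k : Type u} {A : Type v} [Field k] [Ring A] [Algebra k A]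
variable {M : Type w} [AddCommGroup M] [Module A M] {N : Type w'} [AddCommGroup N] [Module A N]

theorem isScalarTower_compHom (k : Type u) (A : Type v) [Field k] [Ring A] [Algebra k A]
    (M : Type w) [AddCommGroup M] [Module A M] :
    letI := Module.compHom M (algebraMap k A)
    IsScalarTower k A M :=
  let := Module.compHom M (algebraMap k A)
  ⟨fun c a m => by rw [Algebra.smul_def, mul_smul]; rfl⟩

theorem IsFinDimModule.of_injective (f : M →ₗ[A] N) (hf : Function.Injective f)
    (hN : IsFinDimModule k A N) : IsFinDimModule k A M := by
  let := Module.compHom M (algebraMap k A)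
  let := Module.compHom N (algebraMap k A)
  have := isScalarTower_compHom k A M
  have := isScalarTower_compHom k A N
  rw [isFinDimModule_iff] at hN ⊢
  exact Module.Finite.of_injective (f.restrictScalars k) hf

theorem IsFinDimModule.of_surjective (f : M →ₗ[A] N) (hf : Function.Surjective f)
    (hM : IsFinDimModule k A M) : IsFinDimModule k A N := by
  let := Module.compHom M (algebraMap k A)
  let := Module.compHom N (algebraMap k A)
  have := isScalarTower_compHom k A M
  have := isScalarTower_compHom k A N
  rw [isFinDimModule_iff] at hM ⊢
  exact Module.Finite.of_surjective (f.restrictScalars k) hf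

theorem IsFinDimModule.prod (hM : IsFinDimModule k A M) (hN : IsFinDimModule k A N) :
    IsFinDimModule k A (M × N) := by
  let := Module.compHom M (algebraMap k A)
  let := Module.compHom N (algebraMap k A)
  have := isScalarTower_compHom k A M
  have := isScalarTower_compHom k A N
  rw [isFinDimModule_iff] at hM hN ⊢
  infer_instance

theorem IsFinDimModule.isLocallyFiniteModule (hM : IsFinDimModule k A M) :
    IsLocallyFiniteModule k A M :=
  fun L _ => hM.of_injective L.subtype L.injective_subtype

theorem IsFinDimModule.isArtinian (hM : IsFinDimModule k A M) : IsArtinian A M := by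
  let := Module.compHom M (algebraMap k A)
  have := isScalarTower_compHom k A M
  rw [isFinDimModule_iff] at hM
  exact isArtinian_of_tower k inferInstance

/-- A module is locally finite as soon as its cyclic submodules are finite-dimensional. -/
theorem isLocallyFiniteModule_of_span_singleton
    (h : ∀ x : M, IsFinDimModule k A (Submodule.span A {x})) : IsLocallyFiniteModule k A M := by
  intro L hL
  induction L, hL using Submodule.fg_induction with
  | singleton x => exact h x
  | sup L₁ L₂ _ _ h₁ h₂ =>
    refine (h₁.prod h₂).of_surjective
      ((Submodule.inclusion le_sup_left).coprod (Submodule.inclusion le_sup_right)) ?_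
    rintro ⟨x, hx⟩
    obtain ⟨y, hy, z, hz, rfl⟩ := Submodule.mem_sup.1 hx
    exact ⟨(⟨y, hy⟩, ⟨z, hz⟩), rfl⟩

end FiniteDimensionality

/-! ### Residual finiteness and essential extensions -/

section ResidualFiniteness

variable {k : Type u} {A : Type v} [Field k] [Ring A] [Algebra k A]

/-- `A` is left fully RFD iff nonzero elements of finitely generated modules survive in some
finite-dimensional module. -/
theorem isLeftFullyRFD_iff : IsLeftFullyRFD k A ↔
    ∀ (M : Type (max u v)) [AddCommGroup M] [Module A M], Module.Finite A M → ∀ m : M, m ≠ 0 →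
      ∃ (N : ModuleCat.{max u v} A) (f : M →ₗ[A] N), IsFinDimModule k A N ∧ f m ≠ 0 := by
  constructor
  · intro h M _ _ hM m hm
    obtain ⟨ι, N, hN, f, hf, -⟩ := h M hM
    have hfm : f m ≠ 0 := fun h0 => hm (hf (by simpa using h0))
    obtain ⟨i, hi⟩ := Function.ne_iff.1 hfm
    exact ⟨N i, (LinearMap.proj i).comp f, hN i, hi⟩
  · intro h M _ _ hM
    choose N f hN hf using h M hM
    refine ⟨{m : M // m ≠ 0}, fun m => ModuleCat.of A (LinearMap.range (f m.1 m.2)),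
      fun m => (hN m.1 m.2).of_injective _ (Submodule.injective_subtype _),
      LinearMap.pi fun m => (f m.1 m.2).rangeRestrict, ?_,
      fun m => (f m.1 m.2).surjective_rangeRestrict⟩
    refine (injective_iff_map_eq_zero _).2 fun m hm => by_contra fun h0 => ?_
    exact hf m h0 (congrArg Subtype.val (congrFun hm ⟨m, h0⟩))

/-- Over a left fully RFD algebra, a finitely generated essential extension of an artinian module
`F` is finite-dimensional. -/
theorem IsLeftFullyRFD.isFinDimModule_of_essential (h : IsLeftFullyRFD k A)
    {M : Type (max u v)} [AddCommGroup M] [Module A M] (hM : Module.Finite A M)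
    (F : Submodule A M) [IsArtinian A F] (hF : ∀ L : Submodule A M, L ⊓ F = ⊥ → L = ⊥) :
    IsFinDimModule k A M := by
  -- submodules of `M` that are kernels of maps to finite-dimensional modules
  let S : Set (Submodule A M) := {L | IsFinDimModule k A (M ⧸ L)}
  have htop : ⊤ ∈ S := by
    let := Module.compHom (M ⧸ (⊤ : Submodule A M)) (algebraMap k A)
    have := isScalarTower_compHom k A (M ⧸ (⊤ : Submodule A M))
    exact (isFinDimModule_iff k A _).2 inferInstance
  -- Choose `L` with minimal trace on the artinian `F`. A nonzero `x` in the trace would survive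
  -- under some `f`, and `L ⊓ ker f` would have a smaller trace.
  obtain ⟨_, ⟨L, hL, rfl⟩, hmin⟩ := WellFounded.has_min (wellFounded_lt (α := Submodule A F))
    ((fun L : Submodule A M => L.comap F.subtype) '' S) ⟨_, ⊤, htop, rfl⟩
  have hbot : L ⊓ F = ⊥ := by
    refine (Submodule.eq_bot_iff _).2 fun x hx => by_contra fun hx0 => ?_
    obtain ⟨N, f, hN, hfx⟩ := isLeftFullyRFD_iff.1 h M hM x hx0
    refine hmin _ ⟨L ⊓ LinearMap.ker f, ?_, rfl⟩ (lt_of_le_of_ne (fun y hy => hy.1) fun he => ?_)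
    · have hker : LinearMap.ker (L.mkQ.prod f) = L ⊓ LinearMap.ker f := by
        rw [LinearMap.ker_prod, Submodule.ker_mkQ]
      rw [← hker]
      exact (IsFinDimModule.prod hL hN).of_injective ((L.mkQ.prod f).ker.liftQ _ le_rfl)
        (LinearMap.ker_eq_bot.1 (Submodule.ker_liftQ_eq_bot _ _ _ le_rfl))
    · have : (⟨x, hx.2⟩ : F) ∈ (L ⊓ LinearMap.ker f).comap F.subtype := by
        rw [show (L ⊓ LinearMap.ker f).comap F.subtype = L.comap F.subtype from he]
        exact hx.1
      exact hfx this.2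
  have := hF L hbot
  subst this
  exact IsFinDimModule.of_injective (Submodule.mkQ ⊥)
    (LinearMap.ker_eq_bot.1 (Submodule.ker_mkQ _)) hL

end ResidualFiniteness

/-! ### Local finiteness of the finite dual and maps into it -/

section FiniteDual

variable {k : Type u} {A : Type v} [Field k] [Ring A] [Algebra k A]

theorem FiniteDual.ext {φ ψ : FiniteDual k A} (h : ∀ b, φ.1 b = ψ.1 b) : φ = ψ :=
  Subtype.ext (LinearMap.ext h)

/-- An ideal `I` inside the kernel of `φ` annihilates `φ`, so `A • φ` is a quotient of `A ⧸ I`. -/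
theorem isLocallyFiniteModule_finiteDual : IsLocallyFiniteModule k A (FiniteDual k A) := by
  refine isLocallyFiniteModule_of_span_singleton fun φ => ?_
  obtain ⟨I, hI, hIf, hφ⟩ := φ.2
  have hker : I ≤ LinearMap.ker (LinearMap.toSpanSingleton A (FiniteDual k A) φ) := fun a ha =>
    FiniteDual.ext fun b => hφ _ (I.mul_mem_left b ha)
  have hfin : IsFinDimModule k A (A ⧸ I) := (isFinDimModule_iff k A _).2 hIf
  rw [← LinearMap.range_toSpanSingleton, ← Submodule.range_liftQ I _ hker]
  exact hfin.of_surjective _ (LinearMap.surjective_rangeRestrict _)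

/-- A finite-dimensional module is killed by a two-sided ideal of finite codimension. -/
theorem finite_quotient_annihilator {M : Type w} [AddCommGroup M] [Module A M]
    (hM : IsFinDimModule k A M) : Module.Finite k (A ⧸ Module.annihilator A M) := by
  let := Module.compHom M (algebraMap k A)
  have := isScalarTower_compHom k A M
  rw [isFinDimModule_iff] at hM
  let g : A →ₗ[k] Module.End k M := (Algebra.lsmul k k M).toLinearMap
  have hg : LinearMap.ker g = (Module.annihilator A M).restrictScalars k := by
    ext x
    simp [g, Module.mem_annihilator, LinearMap.ext_iff]
  have e : (A ⧸ (Module.annihilator A M).restrictScalars k) ≃ₗ[k] LinearMap.range g :=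
    (Submodule.quotEquivOfEq _ _ hg.symm).trans g.quotKerEquivRange
  exact Module.Finite.equiv (e.symm.trans (Submodule.Quotient.restrictScalarsEquiv k _))

variable {M : Type w} [AddCommGroup M] [Module A M] [Module k M] [IsScalarTower k A M]

/-- The `A`-linear map from a locally finite module to `A°` attached to a linear functional. -/
noncomputable def toFiniteDual (hM : IsLocallyFiniteModule k A M) (l : M →ₗ[k] k) :
    M →ₗ[A] FiniteDual k A where
  toFun m := ⟨l.comp ((LinearMap.toSpanSingleton A M m).restrictScalars k),
    -- The annihilator of `m` alone would only be a left ideal; that of `A • m` is two-sided.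
    Module.annihilator A (Submodule.span A {m}), inferInstance,
    finite_quotient_annihilator (hM _ (Submodule.fg_span_singleton m)), fun x hx => by
      have : x • m = 0 := congrArg Subtype.val
        (Module.mem_annihilator.1 hx ⟨m, Submodule.mem_span_singleton_self m⟩)
      simp [this]⟩
  map_add' m n := FiniteDual.ext fun b =>
    (congrArg l (smul_add b m n)).trans (map_add l _ _)
  map_smul' a m := FiniteDual.ext fun b => congrArg l (smul_smul b a m)

theorem toFiniteDual_apply (hM : IsLocallyFiniteModule k A M) (l : M →ₗ[k] k) (m : M) (b : A) :
    (toFiniteDual hM l m).1 b = l (b • m) := rfl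

end FiniteDual

/-! ### Cogenerators and hulls of simple modules -/

section Cogenerator

variable {k : Type u} {A : Type v} [Field k] [Ring A] [Algebra k A]

/-- A module `U` is a cogenerator iff maps to `U` detect nonzero elements of modules. -/
theorem isCoseparator_moduleCat_iff (U : Type w) [AddCommGroup U] [Module A U] [Small.{w} A] :
    CategoryTheory.IsCoseparator (ModuleCat.of A U) ↔
      ∀ (M : Type w) [AddCommGroup M] [Module A M] (m : M), m ≠ 0 →
        ∃ f : M →ₗ[A] U, f m ≠ 0 := by
  rw [CategoryTheory.isCoseparator_def]
  constructor
  · intro h M _ _ m hm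
    by_contra! H
    have h0 := h (X := ModuleCat.of A (Submodule.span A {m})) (Y := ModuleCat.of A M)
      (ModuleCat.ofHom (Submodule.subtype _)) 0 fun g => by
        ext ⟨x, hx⟩
        obtain ⟨a, rfl⟩ := Submodule.mem_span_singleton.1 hx
        have : g.hom m = 0 := H g.hom
        simp [this]
    exact hm (LinearMap.congr_fun (ModuleCat.hom_ext_iff.1 h0)
      ⟨m, Submodule.mem_span_singleton_self m⟩)
  · intro h X Y f g hfg
    ext x
    by_contra hne
    obtain ⟨p, hp⟩ := h Y (f.hom x - g.hom x) (sub_ne_zero.2 hne)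
    have := LinearMap.congr_fun (ModuleCat.hom_ext_iff.1 (hfg (ModuleCat.ofHom p))) x
    exact hp (by rw [map_sub]; exact sub_eq_zero.2 this)

/-- A nonzero element of a module is not killed by some map to the injective hull of a simple
module. -/
theorem exists_map_isInjectiveHull_ne_zero [Small.{w} A] {M : Type w} [AddCommGroup M] [Module A M]
    {m : M} (hm : m ≠ 0) :
    ∃ (V E : Type w) (_ : AddCommGroup V) (_ : Module A V) (_ : AddCommGroup E) (_ : Module A E)
      (i : V →ₗ[A] E) (f : M →ₗ[A] E), IsSimpleModule A V ∧ IsInjectiveHull i ∧ f m ≠ 0 := by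
  let C := Submodule.span A {m}
  let m' : C := ⟨m, Submodule.mem_span_singleton_self m⟩
  have hm'top : Submodule.span A {m'} = ⊤ := by
    refine eq_top_iff.2 ?_
    rintro ⟨x, hx⟩ -
    obtain ⟨a, rfl⟩ := Submodule.mem_span_singleton.1 hx
    exact Submodule.mem_span_singleton.2 ⟨a, rfl⟩
  have : Module.Finite A C := Module.Finite.span_singleton A m
  have : Nontrivial C := ⟨m', 0, fun h => hm (congrArg Subtype.val h)⟩
  -- The cyclic module `C` has a maximal submodule, which cannot contain the generator `m'`.
  obtain ⟨L, hL, -⟩ := (eq_top_or_exists_le_coatom (⊥ : Submodule A C)).resolve_left bot_ne_top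
  have hm'L : m' ∉ L := fun h =>
    hL.1 (top_le_iff.1 (hm'top ▸ (Submodule.span_singleton_le_iff_mem _ _).2 h))
  obtain ⟨E, _, _, i, hi⟩ := exists_isInjectiveHull (A := A) (C ⧸ L)
  obtain ⟨f, hf⟩ := hi.injective_module.out C.subtype C.injective_subtype (i.comp L.mkQ)
  refine ⟨C ⧸ L, E, inferInstance, inferInstance, inferInstance, inferInstance, i, f,
    isSimpleModule_iff_isCoatom.2 hL, hi, fun h0 => hm'L ?_⟩
  rw [← Submodule.Quotient.mk_eq_zero]
  exact hi.injective (by rw [map_zero]; exact (hf m').symm.trans h0)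

end Cogenerator

/-! ### The equivalences -/

section Equivalences

variable {k : Type u} {A : Type v} [Field k] [Ring A] [Algebra k A]

/-- The trace of `M` on each finitely generated `N` is essential in `N`. Only this trace need be
artinian, which serves both simple and locally finite `M`. -/
theorem IsLeftFullyRFD.isLocallyFiniteModule_of_isInjectiveHull (h : IsLeftFullyRFD k A)
    {M E : Type (max u v)} [AddCommGroup M] [Module A M] [AddCommGroup E] [Module A E]
    {i : M →ₗ[A] E} (hi : IsInjectiveHull i)
    (hM : ∀ N : Submodule A E, N.FG → IsArtinian A (N.comap i)) :
    IsLocallyFiniteModule k A E := by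
  intro N hN
  have := hM N hN
  refine h.isFinDimModule_of_essential (Module.Finite.iff_fg.2 hN)
    (LinearMap.range (i.restrict fun _ hx => hx : N.comap i →ₗ[A] N)) fun L hL => ?_
  have h0 : L.map N.subtype = ⊥ := by
    refine hi.essential _ ((Submodule.eq_bot_iff _).2 ?_)
    rintro _ ⟨⟨y, hy, rfl⟩, m, hm⟩
    have hmem : y ∈ L ⊓ LinearMap.range (i.restrict fun _ hx => hx : N.comap i →ₗ[A] N) :=
      ⟨hy, ⟨m, show i m ∈ N from hm ▸ y.2⟩, Subtype.ext hm⟩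
    rw [hL, Submodule.mem_bot] at hmem
    rw [hmem, map_zero]
  exact Submodule.map_injective_of_injective N.injective_subtype
    (h0.trans (Submodule.map_bot _).symm)

theorem isLeftFullyRFD_tfae (k : Type u) (A : Type v) [Field k] [Ring A] [Algebra k A] :
    List.TFAE [
      IsLeftFullyRFD k A,
      ∀ (V E : Type (max u v)) [AddCommGroup V] [Module A V] [AddCommGroup E] [Module A E]
        (i : V →ₗ[A] E), IsSimpleModule A V → IsInjectiveHull i → IsLocallyFiniteModule k A E,
      CategoryTheory.IsCoseparator (ModuleCat.of A (FiniteDual k A))] := by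
  tfae_have 1 → 2 := fun h V E _ _ _ _ i hV hi =>
    h.isLocallyFiniteModule_of_isInjectiveHull hi fun N _ => inferInstance
  tfae_have 2 → 3 := fun h => by
    refine (isCoseparator_moduleCat_iff _).2 fun M _ _ m hm => ?_
    obtain ⟨V, E, _, _, _, _, i, f, hV, hi, hf⟩ := exists_map_isInjectiveHull_ne_zero (A := A) hm
    let := Module.compHom E (algebraMap k A)
    have := isScalarTower_compHom k A E
    obtain ⟨l, hl⟩ := Module.Projective.exists_dual_ne_zero k hf
    refine ⟨(toFiniteDual (h V E i hV hi) l).comp f, fun h0 => hl ?_⟩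
    have h1 : (toFiniteDual (h V E i hV hi) l (f m)).1 1 = 0 := by
      rw [show toFiniteDual (h V E i hV hi) l (f m) = 0 from h0]; rfl
    rwa [toFiniteDual_apply, one_smul] at h1
  tfae_have 3 → 1 := fun h => isLeftFullyRFD_iff.2 fun M _ _ hM m hm => by
    obtain ⟨f, hf⟩ := (isCoseparator_moduleCat_iff _).1 h M m hm
    refine ⟨ModuleCat.of A (LinearMap.range f), f.rangeRestrict,
      isLocallyFiniteModule_finiteDual _ ?_, fun h0 => hf (congrArg Subtype.val h0)⟩
    exact Module.Finite.iff_fg.1 inferInstance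
  tfae_finish

/-- If the locally finite modules are closed under injective hulls, then `A°` is a retract of its
injective hull. -/
theorem injective_finiteDual
    (h : ∀ (M E : Type (max u v)) [AddCommGroup M] [Module A M] [AddCommGroup E] [Module A E]
        (i : M →ₗ[A] E), IsLocallyFiniteModule k A M → IsInjectiveHull i →
          IsLocallyFiniteModule k A E) :
    Module.Injective A (FiniteDual k A) := by
  obtain ⟨E, _, _, i, hi⟩ := exists_isInjectiveHull (A := A) (FiniteDual k A)
  have hE := h _ E i isLocallyFiniteModule_finiteDual hi
  let := Module.compHom E (algebraMap k A)
  have := isScalarTower_compHom k A E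
  let := Module.compHom (FiniteDual k A) (algebraMap k A)
  have := isScalarTower_compHom k A (FiniteDual k A)
  let ev : FiniteDual k A →ₗ[k] k :=
    { toFun := fun φ => φ.1 1
      map_add' := fun _ _ => rfl
      map_smul' := fun c φ => by
        change φ.1 (1 * algebraMap k A c) = c • φ.1 1
        rw [one_mul, Algebra.algebraMap_eq_smul_one, map_smul] }
  obtain ⟨p, hp⟩ := (i.restrictScalars k).exists_leftInverse_of_injective
    (LinearMap.ker_eq_bot.2 hi.injective)
  -- Evaluation at `1` induces the identity of `A°`, and `ev.comp p` extends it along `i`, so `r`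
  -- retracts `i`.
  let r : E →ₗ[A] FiniteDual k A := toFiniteDual hE (ev.comp p)
  have hr : ∀ φ, r (i φ) = φ := fun φ => FiniteDual.ext fun b => by
    change ev (p (b • i φ)) = _
    rw [← map_smul, show p (i (b • φ)) = b • φ from LinearMap.congr_fun hp (b • φ)]
    exact congrArg φ.1 (one_mul b)
  refine ⟨fun X Y _ _ _ _ f hf g => ?_⟩
  obtain ⟨t, ht⟩ := hi.injective_module.out f hf (i.comp g)
  exact ⟨r.comp t, fun x => by simp [ht, hr]⟩

theorem isLeftFullyRFD_tfae_of_isNoetherianRing (k : Type u) (A : Type v) [Field k] [Ring A]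
    [Algebra k A] [IsNoetherianRing A] :
    List.TFAE [
      IsLeftFullyRFD k A,
      ∀ (V E : Type (max u v)) [AddCommGroup V] [Module A V] [AddCommGroup E] [Module A E]
        (i : V →ₗ[A] E), IsSimpleModule A V → IsInjectiveHull i → IsLocallyFiniteModule k A E,
      CategoryTheory.IsCoseparator (ModuleCat.of A (FiniteDual k A)),
      (∀ (V : Type (max u v)) [AddCommGroup V] [Module A V],
        IsSimpleModule A V → IsFinDimModule k A V) ∧
      (∀ (M E : Type (max u v)) [AddCommGroup M] [Module A M] [AddCommGroup E] [Module A E]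
        (i : M →ₗ[A] E), IsLocallyFiniteModule k A M → IsInjectiveHull i →
          IsLocallyFiniteModule k A E),
      CategoryTheory.Injective (ModuleCat.of A (FiniteDual k A)) ∧
      CategoryTheory.IsCoseparator (ModuleCat.of A (FiniteDual k A))] := by
  have h0 := isLeftFullyRFD_tfae k A
  tfae_have 1 ↔ 2 := h0.out 0 1
  tfae_have 1 ↔ 3 := h0.out 0 2
  tfae_have 1 → 4 := fun h => by
    refine ⟨fun V _ _ hV => ?_, fun M E _ _ _ _ i hM hi =>
      h.isLocallyFiniteModule_of_isInjectiveHull hi fun N hN => ?_⟩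
    · refine h.isFinDimModule_of_essential inferInstance ⊤ fun L hL => by simpa using hL
    · have : Module.Finite A N := Module.Finite.iff_fg.2 hN
      -- Noetherianity makes the trace finitely generated, hence finite-dimensional by local
      -- finiteness of `M`, hence artinian.
      have : IsNoetherian A (N.comap i) :=
        isNoetherian_of_injective (i.restrict fun _ hx => hx : N.comap i →ₗ[A] N)
          fun x y hxy => Subtype.ext (hi.injective (congrArg Subtype.val hxy))
      exact (hM _ (Module.Finite.iff_fg.1 inferInstance)).isArtinian
  tfae_have 4 → 2 := fun h V E _ _ _ _ i hV hi =>
    h.2 V E i (h.1 V hV).isLocallyFiniteModule hi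
  tfae_have 5 → 3 := fun h => h.2
  tfae_have 4 → 5 := fun h =>
    have := injective_finiteDual h.2
    ⟨Module.injective_object_of_injective_module A (FiniteDual k A),
      tfae_1_iff_3.1 (tfae_1_iff_2.2 (tfae_4_to_2 h))⟩
  tfae_finish

end Equivalences

theorem mainTheorem4 (k : Type u) (A : Type v) [Field k] [Ring A] [Algebra k A] :
    List.TFAE [
      -- (a) `A` is left fully RFD
      IsLeftFullyRFD k A,
      -- (b) the injective hull of every simple left module is locally finite-dimensional
      ∀ (V E : Type (max u v)) [AddCommGroup V] [Module A V] [AddCommGroup E] [Module A E]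
        (i : V →ₗ[A] E), IsSimpleModule A V → IsInjectiveHull i → IsLocallyFiniteModule k A E,
      -- (c) `A°` is a cogenerator
      CategoryTheory.IsCoseparator (ModuleCat.of A (FiniteDual k A))] ∧
    (IsNoetherianRing A → List.TFAE [
      IsLeftFullyRFD k A,
      ∀ (V E : Type (max u v)) [AddCommGroup V] [Module A V] [AddCommGroup E] [Module A E]
        (i : V →ₗ[A] E), IsSimpleModule A V → IsInjectiveHull i → IsLocallyFiniteModule k A E,
      CategoryTheory.IsCoseparator (ModuleCat.of A (FiniteDual k A)),
      -- (d) simple left modules are finite-dimensional, and the locally finite modules are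
      -- closed under injective hulls
      (∀ (V : Type (max u v)) [AddCommGroup V] [Module A V],
        IsSimpleModule A V → IsFinDimModule k A V) ∧
      (∀ (M E : Type (max u v)) [AddCommGroup M] [Module A M] [AddCommGroup E] [Module A E]
        (i : M →ₗ[A] E), IsLocallyFiniteModule k A M → IsInjectiveHull i →
          IsLocallyFiniteModule k A E),
      -- (e) `A°` is an injective cogenerator
      CategoryTheory.Injective (ModuleCat.of A (FiniteDual k A)) ∧
      CategoryTheory.IsCoseparator (ModuleCat.of A (FiniteDual k A))]) := by
  exact ⟨isLeftFullyRFD_tfae k A, fun _ => isLeftFullyRFD_tfae_of_isNoetherianRing k A⟩
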